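/- Let $m$ be the number of indicators, let $\mu_j,\gamma_j\in\mathbb R$, $\sigma_j>0$ ($1\le j\le m$), and let $W=[w_{jh}]$ be a weight matrix with $w_{jh}=w_j>0$ for all subjects $h=1,2,\dots$. Suppose that there are no missing data and that the data follow the weighted single factor model: the indicator vectors $Y_{\cdot h}=(Y_{1h},\dots,Y_{mh})$, $h=1,2,\dots$, are independent, for each $h$ there is a latent variable $\alpha_h\sim N(0,1)$, and conditionally on $\alpha_h$ the variables $Y_{1h},\dots,Y_{mh}$ are independent with $Y_{jh}\mid\alpha_h\sim N(\mu_j+\gamma_j\alpha_h,\ \sigma_j^2/w_j)$. Let $\varphi(\,\cdot\,;\mu,\sigma^2)$ be the density of $N(\mu,\sigma^2)$, and define the marginal pseudo likelihood of subject $h$, its negative logarithm, and the average over the first $H$ subjects by $$\mathcal L^*_h=\int_{\mathbb R}\varphi(a;0,1)\prod_{j=1}^m\varphi(Y_{jh};\mu_j+\gamma_j a,\sigma_j^2)^{w_{jh}}\,da,\qquad \mathrm{NWMLL}_h=-\log\mathcal L^*_h,\qquad \mathrm{ENWMLL}_H=\frac1H\sum_{h=1}^H\mathrm{NWMLL}_h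 .$$ Then, as $H\to\infty$, $$2\,\mathrm{ENWMLL}_H\xrightarrow{a.s.}\ell:=m+\log\Big[\Big(1+\sum_{j=1}^m\frac{w_j\gamma_j^2}{\sigma_j^2}\Big)\prod_{j=1}^m\frac{\sigma_j^2}{w_j}\Big]+\sum_{j=1}^m(w_j-1)\log\sigma_j^2+\sum_{j=1}^m\log w_j+\sum_{j=1}^m w_j\log 2\pi .$$ Moreover, the central limit theorem holds for $\mathrm{NWMLL}$: the variables $\mathrm{NWMLL}_h$ have finite second moments, common mean $\ell/2$ and a common variance $v<\infty$, and $\sqrt H\,(\mathrm{ENWMLL}_H-\ell/2)$ converges in distribution to $N(0,v)$. -/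

import Mathlib

open MeasureTheory ProbabilityTheory Filter Topology

noncomputable section

/-- The joint pseudo likelihood of the indicators `y = (y_1, …, y_m)` of one subject and of its
latent variable `a`, for the measure-specific weights `w = (w_1, …, w_m)` of that subject: the
standard normal density at `a` times `∏ j, (density of N(μ_j + γ_j a, σ_j ^ 2) at y_j) ^ w_j`. -/
def jointPseudoLikelihood {m : ℕ} (μ γ σ w y : Fin m → ℝ) (a : ℝ) : ℝ :=
  gaussianPDFReal 0 1 a *
    ∏ j, gaussianPDFReal (μ j + γ j * a) (Real.toNNReal (σ j ^ 2)) (y j) ^ w j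

/-- The marginal pseudo likelihood of one subject: the joint pseudo likelihood with the latent
variable integrated out. -/
def marginalPseudoLikelihood {m : ℕ} (μ γ σ w y : Fin m → ℝ) : ℝ :=
  ∫ a : ℝ, jointPseudoLikelihood μ γ σ w y a

/-- The negative (weighted) pseudo marginal log-likelihood of one subject. -/
def NWMLL {m : ℕ} (μ γ σ w y : Fin m → ℝ) : ℝ :=
  -Real.log (marginalPseudoLikelihood μ γ σ w y)

/-- The average over the first `H` subjects of the negative pseudo marginal log-likelihoods, for
the weight matrix `W` and the data `y` (`W j h` and `y j h` belong to indicator `j` and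
subject `h`). -/
def ENWMLL {m : ℕ} (μ γ σ : Fin m → ℝ) (W y : Fin m → ℕ → ℝ) (H : ℕ) : ℝ :=
  (1 / (H : ℝ)) * ∑ h ∈ Finset.range H, NWMLL μ γ σ (fun j => W j h) (fun j => y j h)

/-- The single factor model with (positive) measure-specific weights `W`: the latent variable
`α h` of each subject is standard normal; given `α h`, the indicators `Y 1 h, …, Y m h` are
independent with laws `N(μ_j + γ_j α_h, σ_j ^ 2 / W_{jh})` (so that their conditional joint law is
the product of these normal laws); and the indicator vectors of different subjects are
independent. -/
structure IsWeightedFactorModel {Ω : Type*} [MeasurableSpace Ω] (P : Measure Ω)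
    [IsProbabilityMeasure P] {m : ℕ} (μ γ σ : Fin m → ℝ) (W : Fin m → ℕ → ℝ)
    (α : ℕ → Ω → ℝ) (Y : Fin m → ℕ → Ω → ℝ) : Prop where
  measurable_latent : ∀ h, Measurable (α h)
  measurable_indicator : ∀ j h, Measurable (Y j h)
  law_latent : ∀ h, P.map (α h) = gaussianReal 0 1
  condLaw_indicators : ∀ h, ∀ᵐ a ∂(P.map (α h)),
    condDistrib (fun ω j => Y j h ω) (α h) P a =
      Measure.pi fun j => gaussianReal (μ j + γ j * a) (Real.toNNReal (σ j ^ 2 / W j h))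
  indep_subjects : iIndepFun (fun (h : ℕ) ω (j : Fin m) => Y j h ω) P

/-- The claimed almost sure limit of twice the average negative pseudo marginal
log-likelihood. -/
def limitValue {m : ℕ} (γ σ w : Fin m → ℝ) : ℝ :=
  m + Real.log ((1 + ∑ j, w j * γ j ^ 2 / σ j ^ 2) * ∏ j, (σ j ^ 2 / w j))
    + ∑ j, (w j - 1) * Real.log (σ j ^ 2) + ∑ j, Real.log (w j)
    + ∑ j, w j * Real.log (2 * Real.pi)

end

/-! The joint pseudo likelihood is the exponential of a quadratic polynomial in the latent variable,
so integrating it out leaves a closed form: `NWMLL` is a constant plus a quadratic form in `y - μ`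
(`NWMLL_eq`). Under the model, each indicator vector is distributed as an affine image of
independent centred Gaussians, the latent variable and the errors (`map_eq_map_indicatorsOfErrors`).
Hence the `NWMLL` of the subjects are i.i.d. quadratic polynomials in Gaussians, so square
integrable, and the strong law and the classical CLT apply. Only the mean needs computing, and it
involves second moments alone (`two_mul_integral_NWMLL_indicatorsOfErrors`). -/

/-! ### Closed form of the marginal pseudo likelihood -/

lemma gaussianPDFReal_eq_exp (ν x : ℝ) {v : ℝ} (hv : 0 < v) :
    gaussianPDFReal ν v.toNNReal x =
      Real.exp (-(1 / 2) * (Real.log (2 * Real.pi * v) + (x - ν) ^ 2 / v)) := by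
  have h : 0 < 2 * Real.pi * v := by positivity
  rw [gaussianPDFReal, Real.coe_toNNReal v hv.le, mul_add, Real.exp_add]
  congr 1
  · rw [Real.sqrt_eq_rpow, ← Real.rpow_neg h.le, Real.rpow_def_of_pos h, mul_comm]
  · congr 1
    field_simp

/-- Completing the square recentres the integrand at `B / b`. -/
lemma integral_exp_neg_half_mul_sq_add_mul {b : ℝ} (hb : 0 < b) (B : ℝ) :
    ∫ a : ℝ, Real.exp (-(1 / 2) * (b * a ^ 2) + B * a) =
      Real.exp (B ^ 2 / (2 * b)) * √(2 * Real.pi / b) := by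
  have h : ∀ a : ℝ, Real.exp (-(1 / 2) * (b * a ^ 2) + B * a) =
      Real.exp (B ^ 2 / (2 * b)) * Real.exp (-(b / 2) * (a - B / b) ^ 2) := by
    intro a
    rw [← Real.exp_add]
    congr 1
    field_simp
    ring
  simp_rw [h]
  rw [integral_const_mul, integral_sub_right_eq_self (fun a : ℝ => Real.exp (-(b / 2) * a ^ 2)),
    integral_gaussian]
  congr 2
  field_simp

section

variable {m : ℕ}

lemma jointPseudoLikelihood_eq_exp (μ γ σ w y : Fin m → ℝ) (hσ : ∀ j, 0 < σ j) (a : ℝ) :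
    jointPseudoLikelihood μ γ σ w y a =
      Real.exp (-(1 / 2) * (Real.log (2 * Real.pi) +
          ∑ j, w j * Real.log (2 * Real.pi * σ j ^ 2) +
          ∑ j, w j / σ j ^ 2 * (y j - μ j) ^ 2)) *
      Real.exp (-(1 / 2) * ((1 + ∑ j, w j * γ j ^ 2 / σ j ^ 2) * a ^ 2) +
          (∑ j, w j / σ j ^ 2 * γ j * (y j - μ j)) * a) := by
  have h1 : gaussianPDFReal 0 1 a =
      Real.exp (-(1 / 2) * (Real.log (2 * Real.pi) + a ^ 2)) := by
    simpa using gaussianPDFReal_eq_exp 0 a one_pos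
  have h2 : ∀ j, gaussianPDFReal (μ j + γ j * a) (Real.toNNReal (σ j ^ 2)) (y j) ^ w j =
      Real.exp (-(1 / 2) * (w j * Real.log (2 * Real.pi * σ j ^ 2))
        + -(1 / 2) * (w j / σ j ^ 2 * (y j - μ j) ^ 2)
        + -(1 / 2) * (w j * γ j ^ 2 / σ j ^ 2) * a ^ 2
        + w j / σ j ^ 2 * γ j * (y j - μ j) * a) := by
    intro j
    have := hσ j
    rw [gaussianPDFReal_eq_exp _ _ (by positivity), ← Real.exp_mul]
    congr 1
    field_simp
    ring
  rw [jointPseudoLikelihood, h1, Finset.prod_congr rfl fun j _ => h2 j, ← Real.exp_sum,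
    ← Real.exp_add, ← Real.exp_add]
  congr 1
  simp only [Finset.sum_add_distrib, ← Finset.mul_sum, ← Finset.sum_mul]
  ring

lemma one_add_sum_pos {γ σ w : Fin m → ℝ} (hw : ∀ j, 0 < w j) :
    0 < 1 + ∑ j, w j * γ j ^ 2 / σ j ^ 2 :=
  add_pos_of_pos_of_nonneg one_pos
    (Finset.sum_nonneg fun j _ => div_nonneg (mul_nonneg (hw j).le (sq_nonneg _)) (sq_nonneg _))

lemma NWMLL_eq (μ γ σ w y : Fin m → ℝ) (hσ : ∀ j, 0 < σ j) (hw : ∀ j, 0 < w j) :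
    NWMLL μ γ σ w y = (1 / 2) * (∑ j, w j * Real.log (2 * Real.pi * σ j ^ 2) +
      Real.log (1 + ∑ j, w j * γ j ^ 2 / σ j ^ 2) +
      ∑ j, w j / σ j ^ 2 * (y j - μ j) ^ 2 -
      (∑ j, w j / σ j ^ 2 * γ j * (y j - μ j)) ^ 2 / (1 + ∑ j, w j * γ j ^ 2 / σ j ^ 2)) := by
  have hb : 0 < 1 + ∑ j, w j * γ j ^ 2 / σ j ^ 2 := one_add_sum_pos hw
  have hpi : 0 < 2 * Real.pi := by positivity
  rw [NWMLL, marginalPseudoLikelihood]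
  simp_rw [jointPseudoLikelihood_eq_exp μ γ σ w y hσ]
  rw [integral_const_mul, integral_exp_neg_half_mul_sq_add_mul hb,
    Real.log_mul (Real.exp_ne_zero _) (by positivity),
    Real.log_mul (Real.exp_ne_zero _) (by positivity), Real.log_exp, Real.log_exp,
    Real.log_sqrt (by positivity), Real.log_div hpi.ne' hb.ne']
  field_simp
  ring

lemma measurable_NWMLL (μ γ σ w : Fin m → ℝ) (hσ : ∀ j, 0 < σ j) (hw : ∀ j, 0 < w j) :
    Measurable (NWMLL μ γ σ w) := by
  have : NWMLL μ γ σ w = _ := funext fun y => NWMLL_eq μ γ σ w y hσ hw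
  rw [this]
  fun_prop

/-- The terms `log (w j)` cancel, which leaves the constant of `NWMLL_eq` plus `m`; the quadratic
part must therefore have mean `m`. -/
lemma limitValue_eq (γ σ w : Fin m → ℝ) (hσ : ∀ j, 0 < σ j) (hw : ∀ j, 0 < w j) :
    limitValue γ σ w = ∑ j, w j * Real.log (2 * Real.pi * σ j ^ 2) +
      Real.log (1 + ∑ j, w j * γ j ^ 2 / σ j ^ 2) + m := by
  have hσ2 : ∀ j, 0 < σ j ^ 2 := fun j => pow_pos (hσ j) 2
  have hq : ∀ j, 0 < σ j ^ 2 / w j := fun j => div_pos (hσ2 j) (hw j)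
  have h1 : ∀ j, Real.log (σ j ^ 2 / w j) = Real.log (σ j ^ 2) - Real.log (w j) :=
    fun j => Real.log_div (hσ2 j).ne' (hw j).ne'
  have h2 : ∀ j, w j * Real.log (2 * Real.pi * σ j ^ 2) =
      w j * Real.log (2 * Real.pi) + w j * Real.log (σ j ^ 2) := by
    intro j
    rw [Real.log_mul (by positivity) (hσ2 j).ne', mul_add]
  rw [limitValue, Real.log_mul (one_add_sum_pos hw).ne'
    (Finset.prod_pos fun j _ => hq j).ne', Real.log_prod fun j _ => (hq j).ne']
  simp only [h1, h2, sub_mul, one_mul, Finset.sum_add_distrib, Finset.sum_sub_distrib]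
  ring

/-! ### Moments of linear forms in the latent variable and the errors -/

/-- The joint law of the latent variable and of the independent centred errors of the indicators,
which have variances `v j`. -/
noncomputable abbrev factorErrorLaw (v : Fin m → NNReal) : Measure (ℝ × (Fin m → ℝ)) :=
  (gaussianReal 0 1).prod (Measure.pi fun j => gaussianReal 0 (v j))

lemma memLp_latent_add_sum (v : Fin m → NNReal) (s : ℝ) (c : Fin m → ℝ) {p : ENNReal}
    (hp : p ≠ ⊤) :
    MemLp (fun x : ℝ × (Fin m → ℝ) => s * x.1 + ∑ j, c j * x.2 j) p (factorErrorLaw v) := by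
  have h1 : MemLp (fun a : ℝ => s * a) p (gaussianReal 0 1) :=
    (memLp_id_gaussianReal' p hp).const_mul s
  have h2 : MemLp (fun e : Fin m → ℝ => ∑ j, c j * e j) p
      (Measure.pi fun j => gaussianReal 0 (v j)) :=
    memLp_finsetSum _ fun j _ => ((memLp_id_gaussianReal' p hp).comp_measurePreserving
      (measurePreserving_eval (fun j => gaussianReal 0 (v j)) j)).const_mul (c j)
  exact (h1.comp_fst _).add (h2.comp_snd _)

/-- The form is centred, so its second moment is its variance, which adds over independent
coordinates. -/
lemma integral_latent_add_sum_sq (v : Fin m → NNReal) (s : ℝ) (c : Fin m → ℝ) :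
    ∫ x, (s * x.1 + ∑ j, c j * x.2 j) ^ 2 ∂(factorErrorLaw v) = s ^ 2 + ∑ j, c j ^ 2 * v j := by
  have i1 : MemLp (fun a : ℝ => s * a) 2 (gaussianReal 0 1) :=
    (memLp_id_gaussianReal' 2 (by simp)).const_mul s
  have i3 : ∀ j, MemLp (fun e : ℝ => c j * e) 2 (gaussianReal 0 (v j)) := fun j =>
    (memLp_id_gaussianReal' 2 (by simp)).const_mul (c j)
  have i4 : ∀ j, MemLp (fun e : Fin m → ℝ => c j * e j) 2
      (Measure.pi fun j => gaussianReal 0 (v j)) := fun j =>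
    (i3 j).comp_measurePreserving (measurePreserving_eval (fun j => gaussianReal 0 (v j)) j)
  have i2 : MemLp (fun e : Fin m → ℝ => ∑ j, c j * e j) 2
      (Measure.pi fun j => gaussianReal 0 (v j)) := memLp_finsetSum _ fun j _ => i4 j
  have hmean : ∫ x, (s * x.1 + ∑ j, c j * x.2 j) ∂(factorErrorLaw v) = 0 := by
    rw [integral_add ((i1.comp_fst _).integrable (by simp))
      ((i2.comp_snd _).integrable (by simp)), integral_fun_fst (fun a : ℝ => s * a),
      integral_fun_snd (fun e : Fin m → ℝ => ∑ j, c j * e j),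
      integral_finsetSum _ fun j _ => (i4 j).integrable (by simp)]
    have : ∀ j, ∫ e : Fin m → ℝ, c j * e j ∂(Measure.pi fun j => gaussianReal 0 (v j)) = 0 := by
      intro j
      rw [integral_comp_eval (μ := fun j => gaussianReal 0 (v j)) (f := fun e : ℝ => c j * e)
        (by fun_prop), integral_const_mul, integral_id_gaussianReal, mul_zero]
    have h0 : ∫ a : ℝ, s * a ∂(gaussianReal 0 1) = 0 := by
      rw [integral_const_mul, integral_id_gaussianReal, mul_zero]
    simp [this, h0]
  have hvar := variance_add_prod i1 i2
  have hsum := variance_sum_pi i3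
  rw [Finset.sum_fn] at hsum
  rw [← variance_of_integral_eq_zero (by fun_prop) hmean, hvar, hsum]
  have hc : ∀ (r : ℝ) (u : NNReal), Var[fun e : ℝ => r * e; gaussianReal 0 u] = r ^ 2 * u :=
    fun r u => by rw [variance_const_mul, variance_fun_id_gaussianReal]
  simp only [hc, NNReal.coe_one, mul_one]

/-- The indicators are an affine image of the latent variable and the errors. -/
def indicatorsOfErrors (μ γ : Fin m → ℝ) (x : ℝ × (Fin m → ℝ)) (j : Fin m) : ℝ :=
  μ j + γ j * x.1 + x.2 j

lemma measurable_indicatorsOfErrors (μ γ : Fin m → ℝ) :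
    Measurable (indicatorsOfErrors μ γ) := by
  unfold indicatorsOfErrors
  fun_prop

/-- Both sides mix the same conditional law over the law of `A`: a product of normals with means `μ
j + γ j * a` is a translate of the centred product. -/
lemma map_eq_map_indicatorsOfErrors {Ω : Type*} [MeasurableSpace Ω] {P : Measure Ω}
    [IsProbabilityMeasure P] {μ γ : Fin m → ℝ} {v : Fin m → NNReal} {A : Ω → ℝ}
    {Z : Ω → Fin m → ℝ} (hA : Measurable A) (hZ : Measurable Z)
    (hlaw : P.map A = gaussianReal 0 1)
    (hcond : ∀ᵐ a ∂(P.map A), condDistrib Z A P a =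
      Measure.pi fun j => gaussianReal (μ j + γ j * a) (v j)) :
    P.map Z = (factorErrorLaw v).map (indicatorsOfErrors μ γ) := by
  have hpi : ∀ a : ℝ, (Measure.pi fun j => gaussianReal (μ j + γ j * a) (v j)) =
      (Measure.pi fun j => gaussianReal 0 (v j)).map
        (fun e => indicatorsOfErrors μ γ (a, e)) := by
    intro a
    have := Measure.pi_map_pi (μ := fun j => gaussianReal 0 (v j))
      (f := fun j e => μ j + γ j * a + e) (fun j => by fun_prop)
    rw [show (fun e => indicatorsOfErrors μ γ (a, e)) =
      fun (e : Fin m → ℝ) j => μ j + γ j * a + e j from rfl, this]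
    congr 1
    ext1 j
    rw [gaussianReal_map_const_add, zero_add]
  ext s hs
  rw [← condDistrib_comp_map hA.aemeasurable hZ.aemeasurable,
    Measure.bind_apply hs (Kernel.aemeasurable _),
    Measure.map_apply (measurable_indicatorsOfErrors μ γ) hs,
    Measure.prod_apply (measurable_indicatorsOfErrors μ γ hs), ← hlaw]
  refine lintegral_congr_ae ?_
  filter_upwards [hcond] with a ha
  have hmeas : Measurable fun e => indicatorsOfErrors μ γ (a, e) :=
    (measurable_indicatorsOfErrors μ γ).comp measurable_prodMk_left
  rw [ha, hpi, Measure.map_apply hmeas hs]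
  rfl

/-! ### Integrability and mean of `NWMLL` -/

/-- Writing a single error as a sum against `Pi.single` gives every square the shape treated by the
moment lemmas. -/
lemma NWMLL_indicatorsOfErrors (μ γ σ w : Fin m → ℝ) (hσ : ∀ j, 0 < σ j) (hw : ∀ j, 0 < w j)
    (x : ℝ × (Fin m → ℝ)) :
    NWMLL μ γ σ w (indicatorsOfErrors μ γ x) =
      (1 / 2) * (∑ j, w j * Real.log (2 * Real.pi * σ j ^ 2) +
        Real.log (1 + ∑ j, w j * γ j ^ 2 / σ j ^ 2) +
        ∑ j, w j / σ j ^ 2 * (γ j * x.1 + ∑ i, Pi.single (M := fun _ => ℝ) j 1 i * x.2 i) ^ 2 -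
        ((∑ j, w j * γ j ^ 2 / σ j ^ 2) * x.1 + ∑ j, w j / σ j ^ 2 * γ j * x.2 j) ^ 2 /
          (1 + ∑ j, w j * γ j ^ 2 / σ j ^ 2)) := by
  have h1 : ∀ j, indicatorsOfErrors μ γ x j - μ j =
      γ j * x.1 + ∑ i, Pi.single (M := fun _ => ℝ) j 1 i * x.2 i := by
    intro j
    simp [indicatorsOfErrors, Pi.single_apply]
    ring
  have h2 : ∑ j, w j / σ j ^ 2 * γ j * (indicatorsOfErrors μ γ x j - μ j) =
      (∑ j, w j * γ j ^ 2 / σ j ^ 2) * x.1 + ∑ j, w j / σ j ^ 2 * γ j * x.2 j := by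
    rw [Finset.sum_mul, ← Finset.sum_add_distrib]
    refine Finset.sum_congr rfl fun j _ => ?_
    rw [indicatorsOfErrors]
    ring
  rw [NWMLL_eq μ γ σ w _ hσ hw, h2]
  simp only [h1]

lemma memLp_latent_add_sum_sq (v : Fin m → NNReal) (s : ℝ) (c : Fin m → ℝ) :
    MemLp (fun x : ℝ × (Fin m → ℝ) => (s * x.1 + ∑ j, c j * x.2 j) ^ 2) 2
      (factorErrorLaw v) := by
  -- Fourth moments of the linear form give its square in `L²`, by Hölder.
  have h := memLp_latent_add_sum v s c (p := 4) (by simp)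
  have : ENNReal.HolderTriple 4 4 2 := by
    refine ⟨?_⟩
    rw [← ENNReal.toReal_eq_toReal_iff' (by simp) (by simp),
      ENNReal.toReal_add (by simp) (by simp)]
    simp
    norm_num
  simpa only [sq] using h.mul' h

lemma memLp_NWMLL_indicatorsOfErrors (μ γ σ w : Fin m → ℝ) (hσ : ∀ j, 0 < σ j)
    (hw : ∀ j, 0 < w j) (v : Fin m → NNReal) :
    MemLp (fun x => NWMLL μ γ σ w (indicatorsOfErrors μ γ x)) 2 (factorErrorLaw v) := by
  simp only [NWMLL_indicatorsOfErrors μ γ σ w hσ hw]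
  have hQ : MemLp (fun x : ℝ × (Fin m → ℝ) => ∑ j, w j / σ j ^ 2 *
      (γ j * x.1 + ∑ i, Pi.single (M := fun _ => ℝ) j 1 i * x.2 i) ^ 2) 2 (factorErrorLaw v) :=
    memLp_finsetSum _ fun j _ => (memLp_latent_add_sum_sq v _ _).const_mul _
  have hB := (memLp_latent_add_sum_sq v (∑ j, w j * γ j ^ 2 / σ j ^ 2)
    fun j => w j / σ j ^ 2 * γ j).mul_const (1 + ∑ j, w j * γ j ^ 2 / σ j ^ 2)⁻¹
  have hK := memLp_const (μ := factorErrorLaw v) (p := 2)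
    (∑ j, w j * Real.log (2 * Real.pi * σ j ^ 2) +
      Real.log (1 + ∑ j, w j * γ j ^ 2 / σ j ^ 2))
  exact ((hK.add hQ).sub hB).const_mul (1 / 2)

/-- Put `S = ∑ j, w j * γ j ^ 2 / σ j ^ 2`. As the error variances are `σ j ^ 2 / w j`, the weighted
squares have mean `S + m` and the subtracted term has mean `(S ^ 2 + S) / (1 + S) = S`, so `m`
remains. -/
lemma two_mul_integral_NWMLL_indicatorsOfErrors (μ γ σ w : Fin m → ℝ) (hσ : ∀ j, 0 < σ j)
    (hw : ∀ j, 0 < w j) :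
    2 * ∫ x, NWMLL μ γ σ w (indicatorsOfErrors μ γ x)
      ∂(factorErrorLaw fun j => (σ j ^ 2 / w j).toNNReal) = limitValue γ σ w := by
  have hb : 0 < 1 + ∑ j, w j * γ j ^ 2 / σ j ^ 2 := one_add_sum_pos hw
  set v : Fin m → NNReal := fun j => (σ j ^ 2 / w j).toNNReal with hv
  have hvj : ∀ j, (v j : ℝ) = σ j ^ 2 / w j := fun j =>
    Real.coe_toNNReal _ (div_nonneg (sq_nonneg _) (hw j).le)
  have hint := fun s c => (memLp_latent_add_sum_sq v s c).integrable (by simp)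
  simp_rw [NWMLL_indicatorsOfErrors μ γ σ w hσ hw]
  rw [integral_const_mul, integral_sub, integral_add (integrable_const _), integral_finsetSum,
    integral_div, integral_latent_add_sum_sq]
  rotate_left
  · exact fun j _ => (hint _ _).const_mul _
  · exact integrable_finsetSum _ fun j _ => (hint _ _).const_mul _
  · exact (integrable_const _).add (integrable_finsetSum _ fun j _ => (hint _ _).const_mul _)
  · exact (hint _ _).div_const _
  have h1 : ∀ j, ∫ x, w j / σ j ^ 2 *
      (γ j * x.1 + ∑ i, Pi.single (M := fun _ => ℝ) j 1 i * x.2 i) ^ 2 ∂(factorErrorLaw v) =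
      w j * γ j ^ 2 / σ j ^ 2 + 1 := by
    intro j
    have := hσ j
    have := hw j
    rw [integral_const_mul, integral_latent_add_sum_sq]
    simp only [Pi.single_apply, ite_pow, one_pow, ne_eq, OfNat.ofNat_ne_zero, not_false_eq_true,
      zero_pow, ite_mul, one_mul, zero_mul, Finset.sum_ite_eq', Finset.mem_univ, if_true, hvj]
    field_simp
  have h2 : ∀ j, (w j / σ j ^ 2 * γ j) ^ 2 * v j = w j * γ j ^ 2 / σ j ^ 2 := by
    intro j
    have := hσ j
    have := hw j
    rw [hvj]
    field_simp
  simp only [h1, h2, Finset.sum_add_distrib, integral_const, limitValue_eq γ σ w hσ hw]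
  simp only [probReal_univ, one_smul, Finset.sum_const, Finset.card_univ, Fintype.card_fin,
    nsmul_eq_mul, mul_one]
  field_simp
  ring

end


theorem theorem2 {Ω : Type*} [MeasurableSpace Ω] (P : Measure Ω) [IsProbabilityMeasure P]
    {m : ℕ} (μ γ σ : Fin m → ℝ) (hσ : ∀ j, 0 < σ j)
    (w : Fin m → ℝ) (hw : ∀ j, 0 < w j)
    (W : Fin m → ℕ → ℝ) (hW : ∀ j h, W j h = w j)
    (α : ℕ → Ω → ℝ) (Y : Fin m → ℕ → Ω → ℝ)
    (hmodel : IsWeightedFactorModel P μ γ σ W α Y) :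
    -- almost sure convergence
    (∀ᵐ ω ∂P, Tendsto (fun H : ℕ => 2 * ENWMLL μ γ σ W (fun j h => Y j h ω) H) atTop
      (𝓝 (limitValue γ σ w))) ∧
    -- finite second moments, and the limit is twice the common mean
    (∀ h, MemLp (fun ω => NWMLL μ γ σ (fun j => W j h) (fun j => Y j h ω)) 2 P ∧
      2 * ∫ ω, NWMLL μ γ σ (fun j => W j h) (fun j => Y j h ω) ∂P = limitValue γ σ w) ∧
    -- central limit theorem, with the common (finite) variance as limiting variance
    (∃ v : NNReal,
      (∀ h, Var[fun ω => NWMLL μ γ σ (fun j => W j h) (fun j => Y j h ω); P] = v) ∧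
      TendstoInDistribution
        (fun (H : ℕ) ω => Real.sqrt H *
          (ENWMLL μ γ σ W (fun j h => Y j h ω) H - limitValue γ σ w / 2))
        atTop (id : ℝ → ℝ) (fun _ => P) (gaussianReal 0 v)) := by
  obtain rfl : W = fun j _ => w j := funext₂ hW
  set v : Fin m → NNReal := fun j => (σ j ^ 2 / w j).toNNReal
  set X : ℕ → Ω → ℝ := fun h ω => NWMLL μ γ σ w (fun j => Y j h ω)
  have hY : ∀ h, Measurable fun ω j => Y j h ω := fun h =>
    measurable_pi_lambda _ fun j => hmodel.measurable_indicator j h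
  have hg : Measurable (NWMLL μ γ σ w) := measurable_NWMLL μ γ σ w hσ hw
  have hφ : Measurable (indicatorsOfErrors μ γ) := measurable_indicatorsOfErrors μ γ
  have hlaw : ∀ h, P.map (fun ω j => Y j h ω) =
      (factorErrorLaw v).map (indicatorsOfErrors μ γ) := fun h =>
    map_eq_map_indicatorsOfErrors (hmodel.measurable_latent h) (hY h) (hmodel.law_latent h)
      (hmodel.condLaw_indicators h)
  have hXlaw : ∀ h, IdentDistrib (X h) (fun x => NWMLL μ γ σ w (indicatorsOfErrors μ γ x)) P
      (factorErrorLaw v) := fun h => by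
    have hid : IdentDistrib (fun ω j => Y j h ω) (indicatorsOfErrors μ γ) P (factorErrorLaw v) :=
      ⟨(hY h).aemeasurable, hφ.aemeasurable, hlaw h⟩
    exact hid.comp hg
  have hident : ∀ h, IdentDistrib (X h) (X 0) P P := fun h => (hXlaw h).trans (hXlaw 0).symm
  have hL2 : ∀ h, MemLp (X h) 2 P := fun h =>
    (hXlaw h).symm.memLp_snd (memLp_NWMLL_indicatorsOfErrors μ γ σ w hσ hw v)
  have hmean : ∀ h, 2 * ∫ ω, X h ω ∂P = limitValue γ σ w := fun h => by
    rw [(hXlaw h).integral_eq, two_mul_integral_NWMLL_indicatorsOfErrors μ γ σ w hσ hw]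
  have hindep : iIndepFun X P := hmodel.indep_subjects.comp (fun _ => NWMLL μ γ σ w) fun _ => hg
  have hE : ∀ H ω, ENWMLL μ γ σ (fun j _ => w j) (fun j h => Y j h ω) H =
      (∑ h ∈ Finset.range H, X h ω) / H := fun H ω => by
    rw [ENWMLL, one_div, div_eq_inv_mul]
  refine ⟨?_, fun h => ⟨hL2 h, hmean h⟩, Var[X 0; P].toNNReal, fun h => ?_, ?_⟩
  · filter_upwards [strong_law_ae_real X ((hL2 0).integrable (by simp))
      (fun i j hij => hindep.indepFun hij) hident] with ω hω
    simp_rw [hE]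
    rw [← hmean 0]
    exact hω.const_mul 2
  · rw [Real.coe_toNNReal _ (variance_nonneg _ _)]
    exact (hident h).variance_eq
  · have hclt := tendstoInDistribution_inv_sqrt_mul_sum_sub (Y := (id : ℝ → ℝ))
      (P' := gaussianReal 0 Var[X 0; P].toNNReal) HasLaw.id (hL2 0) hindep hident
    convert! hclt using 3 with H ω
    rw [hE, ← hmean 0]
    -- For `H = 0` both normalised sums vanish, since `√0 = 0`.
    rcases Nat.eq_zero_or_pos H with rfl | hH
    · simp
    · have hH' : (0 : ℝ) < H := Nat.cast_pos.2 hH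
      have hs : √(H : ℝ) ≠ 0 := (Real.sqrt_pos.2 hH').ne'
      field_simp
      rw [Real.sq_sqrt hH'.le]
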